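/- For a sequence $x_0,x_1,x_2,\dots$ of real numbers call $x_i$ ($i\ge1$) a local maximum if $x_{i-1}<x_i>x_{i+1}$; if $x_i$ is a local maximum and $x_j$ is the next local maximum after it, the distance between these consecutive maxima is $j-i$. For functions $\psi$ on $[0,1]$ put $(U\psi)(z)=\int_z^1\psi(u)\,du$, $(D\psi)(z)=\int_0^z\psi(u)\,du$, and for a word $w=w_1\cdots w_n$ in the letters $U,D$ let $\langle w\rangle=\int_0^1 (w_1w_2\cdots w_n 1)(z)\,dz$ (the operators applied successively, the last letter first, to the constant function $1$). There is a function $f_m:\{0,1,2,\dots\}\to\mathbb R$ (not depending on the distribution of the sequence) such that: (i) For every sequence $X_0,X_1,X_2,\dots$ of independent, identically distributed real random variables with continuous distribution function and every $i\ge1$, the probability $P_{max}$ that $X_i$ is a local maximum is $P_{max}=\langle UD\rangle=\frac13$, and for every $d\ge 0$ the conditional probability, given that $X_i$ is a local maximum, that the distance from $X_i$ to the next local maximum equals $d$ is $f_m(d)$. (ii) For every $d\ge2$, $$f_m(d)=\frac{\sum_{a=1}^{d-1}\langle U D^{a}U^{d-a}D\rangle}{P_{max}},\qquad \sum_{a=1}^{d-1}\langle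 U D^{a}U^{d-a}D\rangle=2^d\,\frac{(d-1)(d+2)}{(d+3)!},$$ and hence $$f_m(d)=3\cdot 2^d\,\frac{(d-1)(d+2)}{(d+3)!}.$$ (iii) $f_m(0)=f_m(1)=0$ and $\sum_{d\ge0} f_m(d)=1$, so $f_m$ is a probability mass function. (iv) The values of $f_m(d)$ for $d=2,3,\dots,29$ are, in this order, $\tfrac{2}{5}, \tfrac{1}{3}, \tfrac{6}{35}, \tfrac{1}{15}, \tfrac{4}{189}, \tfrac{1}{175}, \tfrac{2}{1485}, \tfrac{4}{14175}, \tfrac{4}{75075}, \tfrac{2}{218295}, \tfrac{4}{2764125}, \tfrac{1}{4729725}, \tfrac{8}{278326125}, \tfrac{1}{273648375}, \tfrac{2}{4583103525}, \tfrac{8}{162820783125}, \tfrac{4}{764299911375}, \tfrac{2}{3781060408125}, \tfrac{4}{78642438249375}, \tfrac{2}{428772250281375}, \tfrac{8}{19566987612046875}, \tfrac{2}{58274046742786875}, \tfrac{4}{1447106344699640625}, \tfrac{8}{37392513326621578125}, \tfrac{8}{501914364595623354375}, \tfrac{4}{3494761822449632109375}, \tfrac{8}{100847608441898396203125}, \tfrac{1}{188217886723358757890625}$.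 -/

import Mathlib

/-- The term `x i` is a local maximum of the sequence `x 0, x 1, x 2, …`: it has a predecessor and
it is strictly larger than both of its neighbours. -/
def IsSeqMax (x : ℕ → ℝ) (i : ℕ) : Prop :=
  1 ≤ i ∧ x (i - 1) < x i ∧ x (i + 1) < x i

/-- `x i` is a local maximum and the next local maximum is `x (i + d)`, at distance `d`. -/
def IsNextMaxDist (x : ℕ → ℝ) (i d : ℕ) : Prop :=
  IsSeqMax x i ∧ 0 < d ∧ IsSeqMax x (i + d) ∧ ∀ k, 0 < k → k < d → ¬ IsSeqMax x (i + k)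

/-- The two letters `U` ("up") and `D` ("down"). -/
inductive UpDown : Type
  | U : UpDown
  | D : UpDown

/-- The integral operators attached to the letters. The variable of integration is the value
`u = F(x) ∈ [0, 1]` of the distribution function: `U` integrates over the values above the current
one, `D` over the values below it. -/
noncomputable def UpDown.op : UpDown → (ℝ → ℝ) → ℝ → ℝ
  | UpDown.U, ψ, z => ∫ u in z..1, ψ u
  | UpDown.D, ψ, z => ∫ u in (0 : ℝ)..z, ψ u

/-- The pattern integral `⟨w⟩` of a word `w` in `U`, `D`: the operators of `w` are applied, the last
letter first, to the constant function `1`, and the result is integrated over `[0, 1]`. -/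
noncomputable def patternIntegral (w : List UpDown) : ℝ :=
  ∫ z in (0 : ℝ)..1, w.foldr UpDown.op (fun _ => 1) z

/-- The word `U Dᵃ Uᵇ D`. -/
def maxToMaxWord (a b : ℕ) : List UpDown :=
  [UpDown.U] ++ List.replicate a UpDown.D ++ List.replicate b UpDown.U ++ [UpDown.D]

/-- The table of values of the probability mass function at the distances `2, 3, …, 29`. -/
def distTable : List ℚ :=
  [2/5, 1/3, 6/35, 1/15, 4/189, 1/175, 2/1485, 4/14175, 4/75075, 2/218295, 4/2764125, 1/4729725,
    8/278326125, 1/273648375, 2/4583103525, 8/162820783125, 4/764299911375, 2/3781060408125,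
    4/78642438249375, 2/428772250281375, 8/19566987612046875, 2/58274046742786875,
    4/1447106344699640625, 8/37392513326621578125, 8/501914364595623354375,
    4/3494761822449632109375, 8/100847608441898396203125, 1/188217886723358757890625]

/-! Ties between neighbours have probability zero. Without ties, a sequence falls after a local
maximum until its first ascent and then rises up to the next maximum. So distance `d` means that the
steps spell `U Dᵃ Uᵈ⁻ᵃ D` for some `a` in `1, …, d - 1`, and `a` is unique.

The probability of a word is its pattern integral: given the current value `c`, the next step
integrates over the values above or below `c`, and in the coordinate `z = F(c)`, which is uniform on
`[0, 1]`, this is `U` or `D` (`measureReal_follows`).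

`U` and `D` are adjoint in `L²[0, 1]`, so `⟨U Dᵃ Uᵇ D⟩` is the integral of `(Uᵇ D 1)(Uᵃ D 1)`, a
product of explicit polynomials in `1 - z`. Summing over `a` leaves truncated binomial sums, which
yield the closed form; its partial sums telescope. -/

open MeasureTheory ProbabilityTheory Set Filter Topology

/-! ### Words of steps and consecutive maxima -/

/-- The sequence `c, x 0, x 1, …` starts with the steps prescribed by the word. -/
def Follows : List UpDown → ℝ → (ℕ → ℝ) → Prop
  | [], _, _ => True
  | UpDown.U :: w, c, x => c < x 0 ∧ Follows w (x 0) (fun k => x (k + 1))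
  | UpDown.D :: w, c, x => x 0 < c ∧ Follows w (x 0) (fun k => x (k + 1))

/-- The sequence `x` follows the word from the index `j` on. -/
def FollowsAt (w : List UpDown) (x : ℕ → ℝ) (j : ℕ) : Prop :=
  Follows w (x j) (fun k => x (j + 1 + k))

theorem followsAt_nil (x : ℕ → ℝ) (j : ℕ) : FollowsAt [] x j ↔ True := Iff.rfl

theorem followsAt_cons_U (w : List UpDown) (x : ℕ → ℝ) (j : ℕ) :
    FollowsAt (UpDown.U :: w) x j ↔ x j < x (j + 1) ∧ FollowsAt w x (j + 1) := by
  simp only [FollowsAt, Follows, add_zero]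
  simp only [add_assoc, add_comm 1]

theorem followsAt_cons_D (w : List UpDown) (x : ℕ → ℝ) (j : ℕ) :
    FollowsAt (UpDown.D :: w) x j ↔ x (j + 1) < x j ∧ FollowsAt w x (j + 1) := by
  simp only [FollowsAt, Follows, add_zero]
  simp only [add_assoc, add_comm 1]

theorem followsAt_append (v w : List UpDown) (x : ℕ → ℝ) (j : ℕ) :
    FollowsAt (v ++ w) x j ↔ FollowsAt v x j ∧ FollowsAt w x (j + v.length) := by
  induction v generalizing j with
  | nil => simp [followsAt_nil]
  | cons l v ih =>
    cases l <;>
    simp [followsAt_cons_U, followsAt_cons_D, ih, and_assoc, add_assoc, add_comm 1]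

theorem followsAt_replicate_U (a : ℕ) (x : ℕ → ℝ) (j : ℕ) :
    FollowsAt (List.replicate a UpDown.U) x j ↔ ∀ k < a, x (j + k) < x (j + k + 1) := by
  induction a with
  | zero => simp [followsAt_nil]
  | succ a ih =>
    rw [Nat.forall_lt_succ_right]
    simp [List.replicate_succ', followsAt_append, ih, followsAt_cons_U, followsAt_nil]

theorem followsAt_replicate_D (a : ℕ) (x : ℕ → ℝ) (j : ℕ) :
    FollowsAt (List.replicate a UpDown.D) x j ↔ ∀ k < a, x (j + k + 1) < x (j + k) := by
  induction a with
  | zero => simp [followsAt_nil]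
  | succ a ih =>
    rw [Nat.forall_lt_succ_right]
    simp [List.replicate_succ', followsAt_append, ih, followsAt_cons_D, followsAt_nil]

theorem isSeqMax_iff_followsAt (x : ℕ → ℝ) (j : ℕ) :
    IsSeqMax x (j + 1) ↔ FollowsAt [UpDown.U, UpDown.D] x j := by
  simp [IsSeqMax, followsAt_cons_U, followsAt_cons_D, followsAt_nil]

theorem followsAt_maxToMaxWord (a b : ℕ) (x : ℕ → ℝ) (j : ℕ) :
    FollowsAt (maxToMaxWord a b) x j ↔ x j < x (j + 1) ∧
      (∀ k < a, x (j + 1 + k + 1) < x (j + 1 + k)) ∧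
      (∀ k < b, x (j + 1 + a + k) < x (j + 1 + a + k + 1)) ∧
      x (j + 1 + a + b + 1) < x (j + 1 + a + b) := by
  simp [maxToMaxWord, followsAt_append, followsAt_replicate_U, followsAt_replicate_D,
    followsAt_cons_U, followsAt_cons_D, followsAt_nil, add_assoc]

theorem not_isNextMaxDist_of_lt_two (x : ℕ → ℝ) (i d : ℕ) (hd : d < 2) :
    ¬ IsNextMaxDist x i d := by
  rintro ⟨h1, h0, h2, -⟩
  obtain rfl : d = 1 := by omega
  exact lt_asymm h1.2.2 (by simpa using h2.2.1)

/-- The word starts at `j`, one index before the maximum `j + 1`, because its first `U` is the step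
into that maximum. Strictly between the two maxima every term has a larger neighbour. -/
theorem isNextMaxDist_of_followsAt {x : ℕ → ℝ} {j a b : ℕ} (ha : 0 < a) (hb : 0 < b)
    (h : FollowsAt (maxToMaxWord a b) x j) : IsNextMaxDist x (j + 1) (a + b) := by
  obtain ⟨h1, h2, h3, h4⟩ := (followsAt_maxToMaxWord a b x j).1 h
  refine ⟨⟨by omega, by simpa using h1, by simpa using h2 0 ha⟩, by omega, ⟨by omega, ?_, ?_⟩, ?_⟩
  · have := h3 (b - 1) (by omega)
    convert this using 2 <;> omega
  · rwa [← add_assoc]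
  · rintro k hk0 hk ⟨-, h5, h6⟩
    rcases lt_or_ge a k with hak | hak
    · have := h3 (k - a) (by omega)
      rw [show j + 1 + a + (k - a) = j + 1 + k by omega] at this
      exact lt_asymm h6 this
    · have := h2 (k - 1) (by omega)
      rw [show j + 1 + (k - 1) = j + 1 + k - 1 by omega,
        show j + 1 + k - 1 + 1 = j + 1 + k by omega] at this
      exact lt_asymm h5 this

/-- The witness `a` is the offset of the first ascent after the maximum. Once the sequence rises it
must keep rising up to the next maximum. -/
theorem exists_followsAt_of_isNextMaxDist {x : ℕ → ℝ} (hx : ∀ n, x n ≠ x (n + 1)) {j d : ℕ}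
    (h : IsNextMaxDist x (j + 1) d) :
    ∃ a ∈ Finset.Ico 1 d, FollowsAt (maxToMaxWord a (d - a)) x j := by
  classical
  have hd : 2 ≤ d := by
    by_contra hd
    exact not_isNextMaxDist_of_lt_two x _ d (by omega) h
  obtain ⟨⟨-, h1, h2⟩, -, ⟨-, h3, h4⟩, h5⟩ := h
  have hlast : x (j + 1 + (d - 1)) < x (j + 1 + (d - 1) + 1) := by
    rw [show j + 1 + (d - 1) = j + 1 + d - 1 by omega,
      show j + 1 + d - 1 + 1 = j + 1 + d by omega]
    exact h3
  have hex : ∃ k, x (j + 1 + k) < x (j + 1 + k + 1) :=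
    ⟨d - 1, hlast⟩
  have hle : Nat.find hex ≤ d - 1 := Nat.find_min' hex hlast
  have hpos : 0 < Nat.find hex := by
    rw [Nat.find_pos]
    exact not_lt.2 h2.le
  have hdown : ∀ k < Nat.find hex, x (j + 1 + k + 1) < x (j + 1 + k) := fun k hk =>
    lt_of_le_of_ne (not_lt.1 (Nat.find_min hex hk)) (hx _).symm
  have hup : ∀ k, Nat.find hex + k < d →
      x (j + 1 + Nat.find hex + k) < x (j + 1 + Nat.find hex + k + 1) := by
    intro k
    induction k with
    | zero => intro _; exact Nat.find_spec hex
    | succ k ih =>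
      intro hk
      by_contra hlt
      -- A descent directly after an ascent would be a local maximum at an offset below `d`.
      refine h5 (Nat.find hex + (k + 1)) (by omega) hk ⟨by omega, ?_, ?_⟩
      · rw [show j + 1 + (Nat.find hex + (k + 1)) - 1 = j + 1 + Nat.find hex + k by omega,
          show j + 1 + (Nat.find hex + (k + 1)) = j + 1 + Nat.find hex + k + 1 by omega]
        exact ih (by omega)
      · rw [← add_assoc]
        exact lt_of_le_of_ne (not_lt.1 hlt) (hx _).symm
  refine ⟨Nat.find hex, Finset.mem_Ico.2 ⟨hpos, by omega⟩, ?_⟩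
  rw [followsAt_maxToMaxWord]
  refine ⟨by simpa using h1, hdown, fun k hk => hup k (by omega), ?_⟩
  rw [show j + 1 + Nat.find hex + (d - Nat.find hex) = j + 1 + d by omega]
  exact h4

/-- The step at offset `a` from the maximum is an ascent in the shorter fall and still a descent in
the longer one. -/
theorem followsAt_maxToMaxWord_disjoint {x : ℕ → ℝ} {j a b d : ℕ} (hab : a < b) (hb : b < d)
    (ha : FollowsAt (maxToMaxWord a (d - a)) x j) : ¬ FollowsAt (maxToMaxWord b (d - b)) x j := by
  intro h
  rw [followsAt_maxToMaxWord] at ha h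
  exact lt_asymm (h.2.1 a hab) (by simpa using ha.2.2.1 0 (by omega))

theorem measurableSet_follows (w : List UpDown) :
    MeasurableSet {p : ℝ × (ℕ → ℝ) | Follows w p.1 p.2} := by
  induction w with
  | nil => simp [Follows]
  | cons l w ih =>
    have hm : Measurable fun p : ℝ × (ℕ → ℝ) => (p.2 0, fun k => p.2 (k + 1)) := by fun_prop
    have h0 : Measurable fun p : ℝ × (ℕ → ℝ) => p.2 0 := by fun_prop
    cases l
    · exact (measurableSet_lt measurable_fst h0).inter (hm ih)
    · exact (measurableSet_lt h0 measurable_fst).inter (hm ih)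

/-! ### Regularity of the operators -/

/-- The result of applying the operators of a word to the constant function `1`. -/
noncomputable def patternFun (w : List UpDown) : ℝ → ℝ := w.foldr UpDown.op (fun _ => 1)

theorem UpDown.hasDerivAt_op_U {f : ℝ → ℝ} (hf : Continuous f) (z : ℝ) :
    HasDerivAt (UpDown.U.op f) (-f z) z :=
  intervalIntegral.integral_hasDerivAt_left (hf.intervalIntegrable _ _)
    hf.aestronglyMeasurable.stronglyMeasurableAtFilter hf.continuousAt

theorem UpDown.hasDerivAt_op_D {f : ℝ → ℝ} (hf : Continuous f) (z : ℝ) :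
    HasDerivAt (UpDown.D.op f) (f z) z :=
  intervalIntegral.integral_hasDerivAt_right (hf.intervalIntegrable _ _)
    hf.aestronglyMeasurable.stronglyMeasurableAtFilter hf.continuousAt

theorem UpDown.continuous_op (l : UpDown) {f : ℝ → ℝ} (hf : Continuous f) :
    Continuous (l.op f) := by
  refine continuous_iff_continuousAt.2 fun z => ?_
  cases l
  · exact (UpDown.hasDerivAt_op_U hf z).continuousAt
  · exact (UpDown.hasDerivAt_op_D hf z).continuousAt

theorem UpDown.continuous_foldr_op (w : List UpDown) {f : ℝ → ℝ} (hf : Continuous f) :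
    Continuous (w.foldr UpDown.op f) := by
  induction w with
  | nil => exact hf
  | cons l w ih => exact l.continuous_op ih

theorem continuous_patternFun (w : List UpDown) : Continuous (patternFun w) :=
  UpDown.continuous_foldr_op w continuous_const

/-! ### Reduction to the uniform distribution -/

section IntegralTransform

variable (ν : Measure ℝ) [IsProbabilityMeasure ν]

theorem nullSingletonClass_of_continuous_cdf (hF : Continuous (cdf ν)) : NullSingletonClass ν := by
  refine ⟨fun a => ?_⟩
  rw [← measure_cdf ν, StieltjesFunction.measure_singleton,
    hF.continuousAt.continuousWithinAt.leftLim_eq]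
  simp

/-- The probability integral transform. -/
theorem map_cdf_eq_restrict_volume (hF : Continuous (cdf ν)) :
    ν.map (cdf ν) = volume.restrict (Icc 0 1) := by
  have : IsProbabilityMeasure (ν.map (cdf ν)) :=
    Measure.isProbabilityMeasure_map hF.measurable.aemeasurable
  refine Measure.ext_of_Iic _ _ fun t => ?_
  rw [Measure.map_apply hF.measurable measurableSet_Iic, Measure.restrict_apply measurableSet_Iic]
  rcases lt_or_ge t 0 with ht | ht
  · have h1 : cdf ν ⁻¹' Iic t = ∅ := by
      ext x
      simpa using ht.trans_le (cdf_nonneg ν x)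
    have h2 : Iic t ∩ Icc 0 1 = ∅ := by
      ext x
      simp only [mem_inter_iff, mem_Iic, mem_Icc, mem_empty_iff_false, iff_false]
      rintro ⟨h, h', -⟩
      linarith
    rw [h1, h2, measure_empty, measure_empty]
  rcases le_or_gt 1 t with ht1 | ht1
  · have h1 : cdf ν ⁻¹' Iic t = univ := eq_univ_of_forall fun x => (cdf_le_one ν x).trans ht1
    have h2 : Iic t ∩ Icc 0 1 = Icc 0 1 := inter_eq_right.2 fun x hx => hx.2.trans ht1
    rw [h1, h2, measure_univ, Real.volume_Icc]
    simp
  have h2 : Iic t ∩ Icc 0 1 = Icc 0 t := by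
    ext x
    simp only [mem_inter_iff, mem_Iic, mem_Icc]
    constructor
    · tauto
    · rintro ⟨h, h'⟩
      exact ⟨h', h, h'.trans ht1.le⟩
  rw [h2, Real.volume_Icc, sub_zero]
  obtain ⟨M, hM⟩ := ((tendsto_cdf_atTop ν).eventually (lt_mem_nhds ht1)).exists
  have hbdd : BddAbove (cdf ν ⁻¹' Iic t) := ⟨M, fun x hx => by
    by_contra hlt
    exact absurd (hM.trans_le (monotone_cdf ν (not_le.1 hlt).le)) (not_lt.2 hx)⟩
  rcases eq_empty_or_nonempty (cdf ν ⁻¹' Iic t) with he | hne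
  · rw [he, measure_empty]
    rcases ht.eq_or_lt with rfl | ht0
    · simp
    obtain ⟨m, hm⟩ := ((tendsto_cdf_atBot ν).eventually (gt_mem_nhds ht0)).exists
    exact absurd he (Nonempty.ne_empty ⟨m, hm.le⟩)
  -- By continuity the sublevel set is closed, so it is the half-line up to its supremum. There `F`
  -- equals `t`, since `F > t` everywhere to the right.
  have hmem : sSup (cdf ν ⁻¹' Iic t) ∈ cdf ν ⁻¹' Iic t :=
    (isClosed_Iic.preimage hF).csSup_mem hne hbdd
  have hset : cdf ν ⁻¹' Iic t = Iic (sSup (cdf ν ⁻¹' Iic t)) := by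
    ext x
    exact ⟨fun hx => le_csSup hbdd hx, fun hx => (monotone_cdf ν hx).trans hmem⟩
  have hval : cdf ν (sSup (cdf ν ⁻¹' Iic t)) = t := by
    refine le_antisymm hmem ?_
    have hlim : Tendsto (cdf ν) (𝓝[>] (sSup (cdf ν ⁻¹' Iic t)))
        (𝓝 (cdf ν (sSup (cdf ν ⁻¹' Iic t)))) := hF.continuousAt.continuousWithinAt
    refine ge_of_tendsto hlim ?_
    filter_upwards [self_mem_nhdsWithin] with y hy
    by_contra hlt
    exact absurd (le_csSup hbdd (show y ∈ cdf ν ⁻¹' Iic t from (not_le.1 hlt).le)) (not_le.2 hy)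
  rw [hset, ← ofReal_cdf, hval]

theorem measure_preimage_cdf (hF : Continuous (cdf ν)) {s : Set ℝ} (hs : MeasurableSet s) :
    ν (cdf ν ⁻¹' s) = volume (s ∩ Icc 0 1) := by
  rw [← Measure.map_apply hF.measurable hs, map_cdf_eq_restrict_volume ν hF,
    Measure.restrict_apply hs]

/-- `F` may be constant on intervals, so `F(y) > F(c)` can be strictly stronger than `y > c`. Both
events have mass `1 - F(c)`, so they differ by a null set. -/
theorem preimage_cdf_Ioi_ae_eq (hF : Continuous (cdf ν)) (c : ℝ) :
    (cdf ν ⁻¹' Ioi (cdf ν c) : Set ℝ) =ᵐ[ν] Ioi c := by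
  refine ae_eq_of_subset_of_measure_ge (fun x hx => ?_) ?_
    (hF.measurable measurableSet_Ioi).nullMeasurableSet (measure_ne_top _ _)
  · by_contra hle
    exact absurd (monotone_cdf ν (not_lt.1 hle)) (not_le.2 hx)
  · have h : Ioi (cdf ν c) ∩ Icc 0 1 = Ioc (cdf ν c) 1 := by
      ext x
      simp only [mem_inter_iff, mem_Ioi, mem_Icc, mem_Ioc]
      exact ⟨fun h => ⟨h.1, h.2.2⟩, fun h => ⟨h.1, (cdf_nonneg ν c).trans h.1.le, h.2⟩⟩
    rw [measure_preimage_cdf ν hF measurableSet_Ioi, h, Real.volume_Ioc, ← compl_Iic,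
      prob_compl_eq_one_sub measurableSet_Iic, ← ofReal_cdf,
      ENNReal.ofReal_sub _ (cdf_nonneg ν c), ENNReal.ofReal_one]

theorem preimage_cdf_Iio_ae_eq (hF : Continuous (cdf ν)) (c : ℝ) :
    (cdf ν ⁻¹' Iio (cdf ν c) : Set ℝ) =ᵐ[ν] Iio c := by
  have := nullSingletonClass_of_continuous_cdf ν hF
  refine ae_eq_of_subset_of_measure_ge (fun x hx => ?_) ?_
    (hF.measurable measurableSet_Iio).nullMeasurableSet (measure_ne_top _ _)
  · by_contra hle
    exact absurd (monotone_cdf ν (not_lt.1 hle)) (not_le.2 hx)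
  · have h : Iio (cdf ν c) ∩ Icc 0 1 = Ico 0 (cdf ν c) := by
      ext x
      simp only [mem_inter_iff, mem_Iio, mem_Icc, mem_Ico]
      exact ⟨fun h => ⟨h.2.1, h.1⟩, fun h => ⟨h.2, h.1, h.2.le.trans (cdf_le_one ν c)⟩⟩
    rw [measure_preimage_cdf ν hF measurableSet_Iio, h, Real.volume_Ico, measure_congr Iio_ae_eq_Iic,
      ← ofReal_cdf, sub_zero]

theorem integral_comp_cdf (hF : Continuous (cdf ν)) {g : ℝ → ℝ} (hg : Continuous g) :
    ∫ y, g (cdf ν y) ∂ν = ∫ u in (0 : ℝ)..1, g u := by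
  rw [← integral_map hF.measurable.aemeasurable hg.aestronglyMeasurable,
    map_cdf_eq_restrict_volume ν hF, intervalIntegral.integral_of_le zero_le_one,
    integral_Icc_eq_integral_Ioc]

theorem setIntegral_Ioi_comp_cdf (hF : Continuous (cdf ν)) {g : ℝ → ℝ} (hg : Continuous g)
    (c : ℝ) : ∫ y in Ioi c, g (cdf ν y) ∂ν = ∫ u in (cdf ν c)..1, g u := by
  rw [← setIntegral_congr_set (preimage_cdf_Ioi_ae_eq ν hF c),
    ← setIntegral_map measurableSet_Ioi hg.aestronglyMeasurable hF.measurable.aemeasurable,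
    map_cdf_eq_restrict_volume ν hF, Measure.restrict_restrict measurableSet_Ioi,
    intervalIntegral.integral_of_le (cdf_le_one ν c)]
  congr 2
  ext x
  simp only [mem_inter_iff, mem_Ioi, mem_Icc, mem_Ioc]
  exact ⟨fun h => ⟨h.1, h.2.2⟩, fun h => ⟨h.1, (cdf_nonneg ν c).trans h.1.le, h.2⟩⟩

theorem setIntegral_Iio_comp_cdf (hF : Continuous (cdf ν)) {g : ℝ → ℝ} (hg : Continuous g)
    (c : ℝ) : ∫ y in Iio c, g (cdf ν y) ∂ν = ∫ u in (0 : ℝ)..(cdf ν c), g u := by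
  rw [← setIntegral_congr_set (preimage_cdf_Iio_ae_eq ν hF c),
    ← setIntegral_map measurableSet_Iio hg.aestronglyMeasurable hF.measurable.aemeasurable,
    map_cdf_eq_restrict_volume ν hF, Measure.restrict_restrict measurableSet_Iio,
    intervalIntegral.integral_of_le (cdf_nonneg ν c), ← integral_Ico_eq_integral_Ioc]
  congr 2
  ext x
  simp only [mem_inter_iff, mem_Iio, mem_Icc, mem_Ico]
  exact ⟨fun h => ⟨h.2.1, h.1⟩, fun h => ⟨h.2, h.1, h.2.le.trans (cdf_le_one ν c)⟩⟩

end IntegralTransform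

/-! ### Probabilities of patterns in an i.i.d. sequence -/

section Sequences

variable {Ω : Type*} [MeasurableSpace Ω] {μ : Measure Ω} {X : ℕ → Ω → ℝ}

theorem indepFun_tail (hX : ∀ n, Measurable (X n)) (hind : iIndepFun X μ) (n : ℕ) :
    IndepFun (X n) (fun ω k => X (n + 1 + k) ω) μ := by
  have h := indep_iSup_of_disjoint (fun i => (hX i).comap_le) hind
    (S := {n}) (T := Ioi n) (by simp)
  rw [IndepFun_iff_Indep]
  refine indep_of_indep_of_le_left (indep_of_indep_of_le_right h ?_) ?_
  · rw [← measurable_iff_comap_le]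
    refine @measurable_pi_lambda _ _ _ (_) _ _ fun k => ?_
    rw [measurable_iff_comap_le]
    exact le_iSup₂_of_le (n + 1 + k) (show n < n + 1 + k by omega) le_rfl
  · exact le_iSup₂_of_le n rfl le_rfl

variable [IsProbabilityMeasure μ]

/-- Fubini: by independence the joint law of `X n` and the later terms is a product measure. -/
theorem measureReal_head_tail (hX : ∀ n, Measurable (X n)) (hind : iIndepFun X μ) (n : ℕ)
    {S : Set (ℝ × (ℕ → ℝ))} (hS : MeasurableSet S) :
    μ.real {ω | (X n ω, fun k => X (n + 1 + k) ω) ∈ S} =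
      ∫ y, μ.real {ω | (y, fun k => X (n + 1 + k) ω) ∈ S} ∂(μ.map (X n)) := by
  have htail : Measurable fun ω k => X (n + 1 + k) ω := by fun_prop
  have hpair : Measurable fun ω => (X n ω, fun k => X (n + 1 + k) ω) := by fun_prop
  have : IsProbabilityMeasure (μ.map fun ω k => X (n + 1 + k) ω) :=
    Measure.isProbabilityMeasure_map htail.aemeasurable
  have hsec : ∀ y, μ {ω | (y, fun k => X (n + 1 + k) ω) ∈ S} =
      (μ.map fun ω k => X (n + 1 + k) ω) (Prod.mk y ⁻¹' S) := fun y => by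
    rw [Measure.map_apply htail (measurable_prodMk_left hS)]
    rfl
  simp only [Measure.real, hsec]
  rw [integral_toReal (measurable_measure_prodMk_left hS).aemeasurable
    (ae_of_all _ fun y => measure_lt_top _ _), ← Measure.prod_apply hS,
    ← (indepFun_tail hX hind n).map_prod_eq_prod_map_map (hX n).aemeasurable htail.aemeasurable,
    Measure.map_apply hpair hS]
  rfl

/-- Induction on the word. Both `n` and `c` stay general, since after one step the value of `X n`
becomes the new starting value and the tail starts at `n + 1`. -/
theorem measureReal_follows (hX : ∀ n, Measurable (X n)) (hind : iIndepFun X μ)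
    (hid : ∀ n, IdentDistrib (X n) (X 0) μ μ) (hF : Continuous (cdf (μ.map (X 0))))
    (w : List UpDown) (n : ℕ) (c : ℝ) :
    μ.real {ω | Follows w c (fun k => X (n + k) ω)} = patternFun w (cdf (μ.map (X 0)) c) := by
  have : IsProbabilityMeasure (μ.map (X 0)) := Measure.isProbabilityMeasure_map (hX 0).aemeasurable
  induction w generalizing n c with
  | nil => simp [Follows, patternFun]
  | cons l w ih =>
    have hshift : ∀ ω, (fun k => X (n + (k + 1)) ω) = fun k => X (n + 1 + k) ω := fun ω => by
      funext k
      rw [add_assoc, add_comm 1]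
    -- `T` will be the half-line above or below `c`, according to the first letter.
    have key : ∀ T : Set ℝ, MeasurableSet T →
        μ.real {ω | X n ω ∈ T ∧ Follows w (X n ω) (fun k => X (n + 1 + k) ω)} =
          ∫ y in T, patternFun w (cdf (μ.map (X 0)) y) ∂(μ.map (X 0)) := fun T hT => by
      have h := measureReal_head_tail hX hind n
        (((measurable_fst hT : MeasurableSet (Prod.fst ⁻¹' T))).inter (measurableSet_follows w))
      refine h.trans ?_
      rw [(hid n).map_eq, ← integral_indicator hT]
      congr 1
      funext y
      by_cases hy : y ∈ T
      · rw [indicator_of_mem hy, ← ih (n + 1) y]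
        simp [hy]
      · simp [hy]
    cases l
    · have h := key (Ioi c) measurableSet_Ioi
      rw [setIntegral_Ioi_comp_cdf _ hF (continuous_patternFun w)] at h
      simpa [Follows, hshift, patternFun, UpDown.op] using h
    · have h := key (Iio c) measurableSet_Iio
      rw [setIntegral_Iio_comp_cdf _ hF (continuous_patternFun w)] at h
      simpa [Follows, hshift, patternFun, UpDown.op] using h

theorem measurableSet_followsAt (hX : ∀ n, Measurable (X n)) (w : List UpDown) (n : ℕ) :
    MeasurableSet {ω | FollowsAt w (fun k => X k ω) n} := by
  have hpair : Measurable fun ω => (X n ω, fun k => X (n + 1 + k) ω) := by fun_prop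
  exact hpair (measurableSet_follows w)

theorem measureReal_followsAt (hX : ∀ n, Measurable (X n)) (hind : iIndepFun X μ)
    (hid : ∀ n, IdentDistrib (X n) (X 0) μ μ) (hF : Continuous (cdf (μ.map (X 0))))
    (w : List UpDown) (n : ℕ) :
    μ.real {ω | FollowsAt w (fun k => X k ω) n} = patternIntegral w := by
  have : IsProbabilityMeasure (μ.map (X 0)) := Measure.isProbabilityMeasure_map (hX 0).aemeasurable
  refine (measureReal_head_tail hX hind n (measurableSet_follows w)).trans ?_
  rw [(hid n).map_eq]
  simp only [mem_ofPred_eq, measureReal_follows hX hind hid hF w (n + 1)]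
  exact integral_comp_cdf _ hF (continuous_patternFun w)

/-- A continuous distribution function has no atoms, so for each fixed value of `X n` a tie has
probability zero. -/
theorem ae_ne_succ (hX : ∀ n, Measurable (X n)) (hind : iIndepFun X μ)
    (hid : ∀ n, IdentDistrib (X n) (X 0) μ μ) (hF : Continuous (cdf (μ.map (X 0)))) :
    ∀ᵐ ω ∂μ, ∀ n, X n ω ≠ X (n + 1) ω := by
  have : IsProbabilityMeasure (μ.map (X 0)) := Measure.isProbabilityMeasure_map (hX 0).aemeasurable
  have := nullSingletonClass_of_continuous_cdf _ hF
  refine ae_all_iff.2 fun n => ?_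
  have hS : MeasurableSet {p : ℝ × (ℕ → ℝ) | p.1 = p.2 0} :=
    measurableSet_eq_fun measurable_fst (by fun_prop)
  have h := measureReal_head_tail hX hind n hS
  have h0 : ∀ y, μ.real {ω | y = X (n + 1) ω} = 0 := fun y => by
    have h1 : {ω | y = X (n + 1) ω} = X (n + 1) ⁻¹' {y} := by
      ext ω
      simp [eq_comm]
    rw [h1, Measure.real, ← Measure.map_apply (hX _) (measurableSet_singleton y),
      (hid _).map_eq, measure_singleton, ENNReal.toReal_zero]
  simp only [mem_ofPred_eq, add_zero, h0, integral_zero] at h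
  rw [measureReal_eq_zero_iff] at h
  rw [ae_iff]
  simpa using h

theorem measureReal_isNextMaxDist (hX : ∀ n, Measurable (X n)) (hind : iIndepFun X μ)
    (hid : ∀ n, IdentDistrib (X n) (X 0) μ μ) (hF : Continuous (cdf (μ.map (X 0)))) (j d : ℕ) :
    μ.real {ω | IsNextMaxDist (fun n => X n ω) (j + 1) d} =
      ∑ a ∈ Finset.Ico 1 d, patternIntegral (maxToMaxWord a (d - a)) := by
  have hae : {ω | IsNextMaxDist (fun n => X n ω) (j + 1) d} =ᵐ[μ]
      (⋃ a ∈ Finset.Ico 1 d,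
        {ω | FollowsAt (maxToMaxWord a (d - a)) (fun k => X k ω) j} : Set Ω) := by
    filter_upwards [ae_ne_succ hX hind hid hF] with ω hω
    refine propext (Iff.trans ?_ (mem_iUnion₂ (x := ω)).symm)
    constructor
    · intro h
      obtain ⟨a, ha, h⟩ := exists_followsAt_of_isNextMaxDist hω h
      exact ⟨a, ha, h⟩
    · rintro ⟨a, ha, h⟩
      rw [Finset.mem_Ico] at ha
      rw [mem_ofPred_eq] at h
      have := isNextMaxDist_of_followsAt (by omega) (by omega) h
      rwa [show a + (d - a) = d by omega] at this
  rw [measureReal_congr hae, measureReal_biUnion_finset]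
  · simp only [measureReal_followsAt hX hind hid hF]
  · intro a ha b hb hab
    simp only [Finset.coe_Ico, mem_Ico] at ha hb
    refine disjoint_left.2 fun ω h1 h2 => ?_
    simp only [mem_ofPred_eq] at h1 h2
    rcases lt_or_gt_of_ne hab with h | h
    · exact followsAt_maxToMaxWord_disjoint h hb.2 h1 h2
    · exact followsAt_maxToMaxWord_disjoint h ha.2 h2 h1
  · exact fun a _ => measurableSet_followsAt hX _ _

theorem cond_isNextMaxDist (hX : ∀ n, Measurable (X n)) (hind : iIndepFun X μ)
    (hid : ∀ n, IdentDistrib (X n) (X 0) μ μ) (hF : Continuous (cdf (μ.map (X 0)))) (j d : ℕ) :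
    (cond μ {ω | IsSeqMax (fun n => X n ω) (j + 1)}).real
      {ω | IsNextMaxDist (fun n => X n ω) (j + 1) d} =
      (∑ a ∈ Finset.Ico 1 d, patternIntegral (maxToMaxWord a (d - a))) /
        patternIntegral [UpDown.U, UpDown.D] := by
  have hset : {ω | IsSeqMax (fun n => X n ω) (j + 1)} =
      {ω | FollowsAt [UpDown.U, UpDown.D] (fun n => X n ω) j} := by
    ext ω
    rw [mem_ofPred_eq, mem_ofPred_eq]
    exact isSeqMax_iff_followsAt _ _
  have hm := measurableSet_followsAt hX [UpDown.U, UpDown.D] j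
  have hsub : {ω | IsSeqMax (fun n => X n ω) (j + 1)} ∩
      {ω | IsNextMaxDist (fun n => X n ω) (j + 1) d} =
      {ω | IsNextMaxDist (fun n => X n ω) (j + 1) d} := inter_eq_right.2 fun ω h => h.1
  rw [Measure.real, cond_apply (hset ▸ hm), hsub, ENNReal.toReal_mul, ENNReal.toReal_inv]
  change (μ.real _)⁻¹ * μ.real _ = _
  rw [measureReal_isNextMaxDist hX hind hid hF, hset, measureReal_followsAt hX hind hid hF,
    div_eq_inv_mul]

end Sequences

/-! ### Adjointness and evaluation of the pattern integrals -/

/-- The letter whose operator is adjoint to the given one in `L²[0, 1]`. -/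
def UpDown.dual : UpDown → UpDown
  | UpDown.U => UpDown.D
  | UpDown.D => UpDown.U

/-- Integration by parts; the boundary terms vanish because `D f` is zero at `0` and `U g` is zero
at `1`. -/
theorem UpDown.integral_op_D_mul {f g : ℝ → ℝ} (hf : Continuous f) (hg : Continuous g) :
    ∫ z in (0 : ℝ)..1, UpDown.D.op f z * g z = ∫ z in (0 : ℝ)..1, f z * UpDown.U.op g z := by
  have h := intervalIntegral.integral_mul_deriv_eq_deriv_mul (a := 0) (b := 1)
    (fun z _ => UpDown.hasDerivAt_op_D hf z) (fun z _ => UpDown.hasDerivAt_op_U hg z)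
    (hf.intervalIntegrable _ _) (hg.neg.intervalIntegrable _ _)
  have h0 : UpDown.D.op f 0 = 0 := intervalIntegral.integral_same
  have h1 : UpDown.U.op g 1 = 0 := intervalIntegral.integral_same
  simp only [mul_neg, intervalIntegral.integral_neg, h0, h1, mul_zero, zero_mul, sub_zero,
    zero_sub, neg_inj] at h
  exact h

theorem UpDown.integral_op_mul (l : UpDown) {f g : ℝ → ℝ} (hf : Continuous f)
    (hg : Continuous g) :
    ∫ z in (0 : ℝ)..1, l.op f z * g z = ∫ z in (0 : ℝ)..1, f z * l.dual.op g z := by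
  cases l
  · have h := UpDown.integral_op_D_mul hg hf
    simp only [mul_comm (g _), mul_comm _ (f _)] at h
    simpa only [mul_comm (f _), UpDown.dual] using h.symm
  · exact UpDown.integral_op_D_mul hf hg

theorem UpDown.integral_foldr_op_mul (w : List UpDown) {f g : ℝ → ℝ} (hf : Continuous f)
    (hg : Continuous g) :
    ∫ z in (0 : ℝ)..1, w.foldr UpDown.op f z * g z =
      ∫ z in (0 : ℝ)..1, f z * (w.reverse.map UpDown.dual).foldr UpDown.op g z := by
  induction w generalizing g with
  | nil => rfl
  | cons l w ih =>
    rw [List.foldr_cons, UpDown.integral_op_mul l (UpDown.continuous_foldr_op w hf) hg,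
      ih (l.dual.continuous_op hg)]
    simp

/-- The initial letters `U Dᵃ` are moved to the other factor; reversing and dualizing them gives `Uᵃ
D`. -/
theorem patternIntegral_maxToMaxWord_eq_integral_mul (a b : ℕ) :
    patternIntegral (maxToMaxWord a b) =
      ∫ z in (0 : ℝ)..1, patternFun (List.replicate b UpDown.U ++ [UpDown.D]) z *
        patternFun (List.replicate a UpDown.U ++ [UpDown.D]) z := by
  have h := UpDown.integral_foldr_op_mul ([UpDown.U] ++ List.replicate a UpDown.D)
    (continuous_patternFun (List.replicate b UpDown.U ++ [UpDown.D]))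
    (continuous_const (y := (1 : ℝ)))
  simpa [patternIntegral, maxToMaxWord, patternFun, UpDown.dual] using h

/-- Start from `D 1 = z = 1 - (1 - z)`; each `U` maps `(1 - z)ⁿ / n!` to the same expression with `n
+ 1`. -/
theorem patternFun_replicate_U_append_D (b : ℕ) (z : ℝ) :
    patternFun (List.replicate b UpDown.U ++ [UpDown.D]) z =
      (1 - z) ^ b / b.factorial - (1 - z) ^ (b + 1) / (b + 1).factorial := by
  induction b generalizing z with
  | zero => simp [patternFun, UpDown.op]
  | succ b ih =>
    have hpow : ∀ (n : ℕ) (u : ℝ), HasDerivAt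
        (fun u : ℝ => -((1 - u) ^ (n + 1) / (n + 1).factorial)) ((1 - u) ^ n / n.factorial) u := by
      intro n u
      have h := ((((hasDerivAt_id u).const_sub 1).pow (n + 1)).div_const
        ((n + 1).factorial : ℝ)).neg
      refine h.congr_deriv ?_
      have := n.cast_add_one_ne_zero (R := ℝ)
      have := n.factorial_ne_zero
      rw [Nat.factorial_succ]
      push_cast
      simp only [id]
      field_simp
    have hd : ∀ u, HasDerivAt (fun u : ℝ => -((1 - u) ^ (b + 1) / (b + 1).factorial) -
        -((1 - u) ^ (b + 2) / (b + 2).factorial))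
        (patternFun (List.replicate b UpDown.U ++ [UpDown.D]) u) u := fun u =>
      ((hpow b u).sub (hpow (b + 1) u)).congr_deriv (ih u).symm
    have h := intervalIntegral.integral_eq_sub_of_hasDerivAt (a := z) (b := 1)
      (fun u _ => hd u) ((continuous_patternFun _).intervalIntegrable _ _)
    change ∫ u in z..1, patternFun (List.replicate b UpDown.U ++ [UpDown.D]) u = _
    rw [h]
    simp
    ring

theorem patternIntegral_maxToMaxWord (a b : ℕ) :
    patternIntegral (maxToMaxWord a b) =
      1 / (a.factorial * b.factorial) / (a + b + 1) -
      (1 / (a.factorial * (b + 1).factorial) + 1 / ((a + 1).factorial * b.factorial)) /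
        (a + b + 2) +
      1 / ((a + 1).factorial * (b + 1).factorial) / (a + b + 3) := by
  rw [patternIntegral_maxToMaxWord_eq_integral_mul]
  simp only [patternFun_replicate_U_append_D]
  rw [intervalIntegral.integral_comp_sub_left (fun t : ℝ =>
    (t ^ b / b.factorial - t ^ (b + 1) / (b + 1).factorial) *
      (t ^ a / a.factorial - t ^ (a + 1) / (a + 1).factorial)) 1]
  have hexp : ∀ t : ℝ, (t ^ b / b.factorial - t ^ (b + 1) / (b + 1).factorial) *
      (t ^ a / a.factorial - t ^ (a + 1) / (a + 1).factorial) =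
      1 / (a.factorial * b.factorial) * t ^ (a + b) -
      (1 / (a.factorial * (b + 1).factorial) + 1 / ((a + 1).factorial * b.factorial)) *
        t ^ (a + b + 1) +
      1 / ((a + 1).factorial * (b + 1).factorial) * t ^ (a + b + 2) := fun t => by
    ring
  simp only [hexp]
  have hc : ∀ (c : ℝ) (n : ℕ), IntervalIntegrable (fun t : ℝ => c * t ^ n) volume 0 1 :=
    fun c n => Continuous.intervalIntegrable (by fun_prop) _ _
  rw [sub_self, sub_zero, intervalIntegral.integral_add ((hc _ _).sub (hc _ _)) (hc _ _),
    intervalIntegral.integral_sub (hc _ _) (hc _ _)]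
  simp only [intervalIntegral.integral_const_mul, integral_pow]
  simp
  ring

theorem patternIntegral_U_D : patternIntegral [UpDown.U, UpDown.D] = 1 / 3 := by
  have h : patternIntegral [UpDown.U, UpDown.D] =
      ∫ z in (0 : ℝ)..1, ((1 - z) - (1 - z) ^ 2 / 2) := by
    refine intervalIntegral.integral_congr fun z _ => ?_
    simpa [patternFun] using patternFun_replicate_U_append_D 1 z
  rw [h, intervalIntegral.integral_comp_sub_left (fun t : ℝ => t - t ^ 2 / 2) 1,
    intervalIntegral.integral_sub (Continuous.intervalIntegrable (by fun_prop) _ _)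
      (Continuous.intervalIntegrable (by fun_prop) _ _)]
  simp
  norm_num

theorem sum_range_inv_factorial_mul_factorial (n : ℕ) :
    ∑ a ∈ Finset.range (n + 1), (1 : ℝ) / (a.factorial * (n - a).factorial) =
      2 ^ n / n.factorial := by
  rw [eq_div_iff (by positivity), Finset.sum_mul]
  have h := Nat.sum_range_choose n
  rw [← Nat.cast_inj (R := ℝ)] at h
  push_cast at h
  rw [← h]
  refine Finset.sum_congr rfl fun a ha => ?_
  rw [Nat.cast_choose ℝ (Nat.lt_succ_iff.1 (Finset.mem_range.1 ha)), one_div_mul_eq_div]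

/-- The evaluated integrals sum to four pieces of the full sums of `1 / (a! (n - a)!) = 2ⁿ / n!`,
with `n = d`, `d + 1` twice, and `d + 2`. Each lacks only a few end terms. -/
theorem sum_patternIntegral_maxToMaxWord (d : ℕ) (hd : 2 ≤ d) :
    ∑ a ∈ Finset.Ico 1 d, patternIntegral (maxToMaxWord a (d - a)) =
      2 ^ d * (((d : ℝ) - 1) * ((d : ℝ) + 2)) / (Nat.factorial (d + 3) : ℝ) := by
  obtain ⟨m, rfl⟩ := Nat.exists_eq_add_of_le' hd
  have h1 := sum_range_inv_factorial_mul_factorial (m + 2)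
  have h2 := sum_range_inv_factorial_mul_factorial (m + 3)
  -- The sum for `n = d + 1` is needed with two windows: `h2` drops the indices `0, d, d + 1`, while
  -- `h3` drops `0, 1, d + 1`.
  have h3 := h2
  have h4 := sum_range_inv_factorial_mul_factorial (m + 4)
  rw [Finset.sum_range_succ, Finset.sum_range_succ'] at h1
  rw [Finset.sum_range_succ, Finset.sum_range_succ, Finset.sum_range_succ'] at h2
  rw [Finset.sum_range_succ, Finset.sum_range_succ', Finset.sum_range_succ'] at h3
  rw [Finset.sum_range_succ, Finset.sum_range_succ, Finset.sum_range_succ',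
    Finset.sum_range_succ'] at h4
  rw [Finset.sum_Ico_eq_sum_range]
  have hterm : ∀ k ∈ Finset.range (m + 1),
      patternIntegral (maxToMaxWord (1 + k) (m + 2 - (1 + k))) =
      1 / ((k + 1).factorial * (m + 2 - (k + 1)).factorial) / (m + 3) -
      (1 / ((k + 1).factorial * (m + 3 - (k + 1)).factorial) +
        1 / ((k + 1 + 1).factorial * (m + 3 - (k + 1 + 1)).factorial)) / (m + 4) +
      1 / ((k + 1 + 1).factorial * (m + 4 - (k + 1 + 1)).factorial) / (m + 5) := by
    intro k hk
    have hk' : k ≤ m := Nat.lt_succ_iff.1 (Finset.mem_range.1 hk)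
    rw [patternIntegral_maxToMaxWord]
    obtain ⟨c, rfl⟩ := Nat.exists_eq_add_of_le hk'
    rw [show k + c + 2 - (1 + k) = c + 1 by omega, show k + c + 2 - (k + 1) = c + 1 by omega,
      show k + c + 3 - (k + 1) = c + 2 by omega, show k + c + 3 - (k + 1 + 1) = c + 1 by omega,
      show k + c + 4 - (k + 1 + 1) = c + 2 by omega, add_comm 1 k]
    push_cast
    ring_nf
  rw [show m + 2 - 1 = m + 1 by omega, Finset.sum_congr rfl hterm, Finset.sum_add_distrib,
    Finset.sum_sub_distrib, ← Finset.sum_div, ← Finset.sum_div, ← Finset.sum_div,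
    Finset.sum_add_distrib]
  rw [← eq_sub_iff_add_eq, ← eq_sub_iff_add_eq] at h1
  rw [← eq_sub_iff_add_eq, ← eq_sub_iff_add_eq, ← eq_sub_iff_add_eq] at h2 h3
  rw [← eq_sub_iff_add_eq, ← eq_sub_iff_add_eq, ← eq_sub_iff_add_eq, ← eq_sub_iff_add_eq] at h4
  rw [h1, h2, h3, h4]
  simp only [show m + 3 - (m + 2) = 1 by omega, show m + 4 - (m + 3) = 1 by omega, Nat.sub_self,
    Nat.sub_zero, zero_add, Nat.factorial_zero, Nat.factorial_one,
    show m + 3 - 1 = m + 2 by omega, show m + 4 - 1 = m + 3 by omega,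
    Nat.factorial_succ (m + 4), Nat.factorial_succ (m + 3), Nat.factorial_succ (m + 2)]
  have := (m + 2).factorial_ne_zero
  push_cast
  field_simp
  ring

/-! ### The mass function, its total mass and its table -/

/-- The probability mass function of the distance between consecutive local maxima. -/
noncomputable def maxDistPMF (d : ℕ) : ℝ :=
  (∑ a ∈ Finset.Ico 1 d, patternIntegral (maxToMaxWord a (d - a))) /
    patternIntegral [UpDown.U, UpDown.D]

theorem maxDistPMF_of_two_le (d : ℕ) (hd : 2 ≤ d) :
    maxDistPMF d = 3 * 2 ^ d * (((d : ℝ) - 1) * ((d : ℝ) + 2)) / (Nat.factorial (d + 3) : ℝ) := by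
  rw [maxDistPMF, sum_patternIntegral_maxToMaxWord d hd, patternIntegral_U_D]
  ring

theorem maxDistPMF_of_lt_two (d : ℕ) (hd : d < 2) : maxDistPMF d = 0 := by
  simp [maxDistPMF, Finset.Ico_eq_empty_of_le (Nat.lt_succ_iff.1 hd)]

/-- The subtracted term is the tail mass beyond `n`; its decrease from `n` to `n + 1` is the mass at
`n + 1`, so the induction telescopes. -/
theorem sum_range_maxDistPMF (n : ℕ) :
    ∑ d ∈ Finset.range (n + 1), maxDistPMF d =
      1 - 3 * 2 ^ (n + 1) * ((n : ℝ) + 1) / ((n + 3).factorial : ℝ) := by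
  induction n with
  | zero => norm_num [maxDistPMF_of_lt_two, Nat.factorial]
  | succ n ih =>
    rw [Finset.sum_range_succ, ih]
    rcases n.eq_zero_or_pos with rfl | hn
    · norm_num [maxDistPMF_of_lt_two, Nat.factorial]
    rw [maxDistPMF_of_two_le _ (by omega), Nat.factorial_succ (n + 3)]
    have := (n + 3).factorial_ne_zero
    push_cast
    field_simp
    ring

theorem hasSum_maxDistPMF : HasSum maxDistPMF 1 := by
  have hnn : ∀ d, 0 ≤ maxDistPMF d := fun d => by
    rcases lt_or_ge d 2 with hd | hd
    · rw [maxDistPMF_of_lt_two d hd]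
    · rw [maxDistPMF_of_two_le d hd]
      have : (2 : ℝ) ≤ d := by exact_mod_cast hd
      have : (0 : ℝ) ≤ d - 1 := by linarith
      positivity
  rw [hasSum_iff_tendsto_nat_of_nonneg hnn, ← tendsto_add_atTop_iff_nat 1]
  simp only [sum_range_maxDistPMF]
  have hlim := ((tendsto_add_atTop_iff_nat 2).2
    (FloorSemiring.tendsto_pow_div_factorial_atTop (2 : ℝ))).const_mul 3
  rw [mul_zero] at hlim
  have h0 : Tendsto (fun n : ℕ => 3 * 2 ^ (n + 1) * ((n : ℝ) + 1) / ((n + 3).factorial : ℝ))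
      atTop (𝓝 0) := by
    -- The tail is bounded by `3 * 2 ^ (n + 2) / (n + 2)!`, because `n + 1 ≤ 2 * (n + 3)`.
    refine squeeze_zero (fun n => by positivity) (fun n => ?_) hlim
    rw [Nat.factorial_succ (n + 2), mul_div_assoc', div_le_div_iff₀ (by positivity) (by positivity)]
    push_cast
    have : (0 : ℝ) ≤ 3 * 2 ^ (n + 1) * (n + 2).factorial := by positivity
    rw [pow_succ _ (n + 1)]
    nlinarith [mul_nonneg this (n.cast_nonneg (α := ℝ))]
  simpa using h0.const_sub 1

/-- Entry `k` belongs to the distance `d = k + 2`, so `d - 1`, `d + 2` and `d + 3` become `k + 1`,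
`k + 4` and `k + 5`. -/
theorem distTable_get (k : Fin distTable.length) :
    distTable.get k =
      3 * 2 ^ ((k : ℕ) + 2) * (((k : ℕ) + 1) * ((k : ℕ) + 4)) / (Nat.factorial (k + 5) : ℚ) := by
  revert k
  decide +kernel

theorem maxDistPMF_add_two (k : Fin distTable.length) :
    maxDistPMF (k + 2) = ((distTable.get k : ℚ) : ℝ) := by
  rw [maxDistPMF_of_two_le _ (by omega), distTable_get]
  push_cast
  ring_nf

theorem mainTheorem2 :
    ∃ f : ℕ → ℝ,
      (∀ (Ω : Type*) [MeasurableSpace Ω] (μ : MeasureTheory.Measure Ω)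
          [MeasureTheory.IsProbabilityMeasure μ] (X : ℕ → Ω → ℝ),
          (∀ n, Measurable (X n)) →
          ProbabilityTheory.iIndepFun X μ →
          (∀ n, ProbabilityTheory.IdentDistrib (X n) (X 0) μ μ) →
          Continuous (ProbabilityTheory.cdf (μ.map (X 0))) →
          ∀ i : ℕ, 1 ≤ i →
            μ.real {ω | IsSeqMax (fun n => X n ω) i} = patternIntegral [UpDown.U, UpDown.D] ∧
            ∀ d : ℕ,
              (ProbabilityTheory.cond μ {ω | IsSeqMax (fun n => X n ω) i}).real
                {ω | IsNextMaxDist (fun n => X n ω) i d} = f d) ∧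
      patternIntegral [UpDown.U, UpDown.D] = 1 / 3 ∧
      (∀ d : ℕ, 2 ≤ d →
        f d = (∑ a ∈ Finset.Ico 1 d, patternIntegral (maxToMaxWord a (d - a))) /
          patternIntegral [UpDown.U, UpDown.D] ∧
        ∑ a ∈ Finset.Ico 1 d, patternIntegral (maxToMaxWord a (d - a)) =
          2 ^ d * (((d : ℝ) - 1) * ((d : ℝ) + 2)) / (Nat.factorial (d + 3) : ℝ) ∧
        f d = 3 * 2 ^ d * (((d : ℝ) - 1) * ((d : ℝ) + 2)) / (Nat.factorial (d + 3) : ℝ)) ∧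
      f 0 = 0 ∧ f 1 = 0 ∧ HasSum f 1 ∧
      (∀ k : Fin distTable.length, f (k + 2) = ((distTable.get k : ℚ) : ℝ)) := by
  refine ⟨maxDistPMF, ?_, patternIntegral_U_D, fun d hd => ⟨rfl,
    sum_patternIntegral_maxToMaxWord d hd, maxDistPMF_of_two_le d hd⟩,
    maxDistPMF_of_lt_two 0 (by norm_num), maxDistPMF_of_lt_two 1 (by norm_num), hasSum_maxDistPMF,
    maxDistPMF_add_two⟩
  intro Ω _ μ _ X hX hind hid hF i hi
  obtain ⟨j, rfl⟩ := Nat.exists_eq_add_of_le' hi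
  refine ⟨?_, cond_isNextMaxDist hX hind hid hF j⟩
  simp only [isSeqMax_iff_followsAt]
  exact measureReal_followsAt hX hind hid hF _ j
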